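/- Let $k,n\ge 0$ be integers. Given inputs $x_1,\dots,x_k\in\{0,1\}^n$, a modified equality query $\mathrm{MEQ}_{k,n}(i,j,y,z)$, with $i,j\in\{1,\dots,k\}$ and $y,z\in\{0,1\}^n$, asks whether $x_i\oplus y=x_j\oplus z$. An $\mathrm{MEQ}_{k,n}$ decision tree with outputs in a set $S$ is a finite rooted binary tree in which every inner node has two children and is labeled by such a query, and every leaf is labeled by an element of $S$. It is evaluated from the root, moving to the right child if the answer to the query at the current node is yes and to the left child otherwise, and it outputs the label of the leaf that is reached. Its depth is the maximum number of inner nodes on a path from the root to a leaf. In a quantum $k$-party simultaneous message-passing ($\mathsf{SMP}$) protocol without shared randomness or entanglement, each player $\ell\in\{1,\dots,k\}$ sends to a referee a quantum state $|\psi_\ell(x_\ell)\rangle$ of $q_\ell$ qubits that depends only on that player's own input $x_\ell$. The referee measures the joint state $|\psi_1(x_1)\rangle\otimes\cdots\otimes|\psi_k(x_k)\rangle$ by a quantum measurement that does not depend on the inputs, and outputs an element of $S$ determined by the outcome. The protocol uses $\sum_{\ell=1}^k q_\ell$ qubits. It implements a decision tree with error probability at most $\delta$ if, for every input $(x_1,\dots,x_k)$,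 the probability that the referee's output differs from the output of the tree is at most $\delta$. **Theorem.** There is a universal constant $C>0$ such that for all integers $n,k,D\ge 0$, every $\delta\in(0,1)$, every set $S$ and every $\mathrm{MEQ}_{k,n}$ decision tree of depth $D$ with outputs in $S$, there is a quantum $k$-party $\mathsf{SMP}$ protocol without shared randomness or entanglement that implements the tree with error probability at most $\delta$ and uses at most $$C\,k\,\bigl(\log \max(D,1)+\log(1/\delta)\bigr)\,\log\max(n,2)$$ qubits; that is, $O\bigl(k(\log D+\log(1/\delta))\log n\bigr)$ qubits. -/

import Mathlib

/-- Bit strings of length `n`. -/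
abbrev BitStr (n : ℕ) : Type := Fin n → Bool

/-- Bitwise exclusive or. -/
def BitStr.bxor {n : ℕ} (x y : BitStr n) : BitStr n := fun t => xor (x t) (y t)

/-- The modified equality query `MEQ_{k,n}(i, j, y, z)` on the inputs `x`:
is `x_i ⊕ y = x_j ⊕ z`? -/
def meq {k n : ℕ} (x : Fin k → BitStr n) (i j : Fin k) (y z : BitStr n) : Bool :=
  decide ((x i).bxor y = (x j).bxor z)

/-- `MEQ_{k,n}` decision trees with outputs in `S`: binary trees whose inner nodes are labeled by
queries `(i, j, y, z)` and whose leaves are labeled by elements of `S`. -/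
inductive MEQTree (k n : ℕ) (S : Type*) where
  | leaf (s : S) : MEQTree k n S
  | node (i j : Fin k) (y z : BitStr n) (left right : MEQTree k n S) : MEQTree k n S

namespace MEQTree

/-- The depth: the largest number of queries on a path from the root to a leaf. -/
def depth {k n : ℕ} {S : Type*} : MEQTree k n S → ℕ
  | leaf _ => 0
  | node _ _ _ _ left right => max left.depth right.depth + 1

/-- The output of the tree: go right if the answer to the query is 1, left if it is 0. -/
def eval {k n : ℕ} {S : Type*} (x : Fin k → BitStr n) : MEQTree k n S → S
  | leaf s => s
  | node i j y z left right => if meq x i j y z = true then right.eval x else left.eval x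

end MEQTree

/-- The state space of a register of `q` qubits, of dimension `2 ^ q`, with the computational basis
indexed by bit strings. -/
abbrev Register (q : ℕ) : Type := EuclideanSpace ℂ (BitStr q)

open scoped ComplexOrder in
/-- A quantum `k`-party simultaneous message-passing protocol with inputs in `{0,1}^n` and outputs
in `S`, without shared randomness or entanglement. The message of player `ℓ` is a state of
`qubits ℓ` qubits that depends on the input of that player only. The referee performs a general
quantum measurement with finitely many outcomes (a POVM) on the joint register of all messages and
outputs a function of the outcome. -/
structure QuantumSMP (k n : ℕ) (S : Type*) where
  /-- the number of qubits sent by each player -/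
  qubits : Fin k → ℕ
  /-- the message of each player, as a function of the player's own input -/
  message : (ℓ : Fin k) → BitStr n → Register (qubits ℓ)
  norm_message : ∀ ℓ x, ‖message ℓ x‖ = 1
  /-- the number of outcomes of the referee's measurement -/
  outcomes : ℕ
  /-- the referee's measurement operators on the joint register -/
  effect : Fin outcomes →
    Matrix ((ℓ : Fin k) → BitStr (qubits ℓ)) ((ℓ : Fin k) → BitStr (qubits ℓ)) ℂ
  effect_posSemidef : ∀ ω, (effect ω).PosSemidef
  sum_effect : ∑ ω, effect ω = 1
  /-- the output of the referee for each measurement outcome -/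
  output : Fin outcomes → S

namespace QuantumSMP

variable {k n : ℕ} {S : Type*}

/-- The communication cost: the total number of qubits sent to the referee. -/
def cost (P : QuantumSMP k n S) : ℕ := ∑ ℓ, P.qubits ℓ

/-- The joint state received by the referee: the tensor product of the messages, written in the
computational basis. -/
noncomputable def jointState (P : QuantumSMP k n S) (x : Fin k → BitStr n) :
    ((ℓ : Fin k) → BitStr (P.qubits ℓ)) → ℂ :=
  fun b => ∏ ℓ, P.message ℓ (x ℓ) (b ℓ)

/-- The probability `⟨ψ| E_ω |ψ⟩` of the measurement outcome `ω` on the inputs `x`. -/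
noncomputable def outcomeProb (P : QuantumSMP k n S) (x : Fin k → BitStr n)
    (ω : Fin P.outcomes) : ℝ :=
  (star (P.jointState x) ⬝ᵥ (P.effect ω).mulVec (P.jointState x)).re

open Classical in
/-- The probability that, on the inputs `x`, the referee's output is different from `s`. -/
noncomputable def errorProb (P : QuantumSMP k n S) (x : Fin k → BitStr n) (s : S) : ℝ :=
  ∑ ω with P.output ω ≠ s, P.outcomeProb x ω

end QuantumSMP

/-!
Each player sends `t` copies of a fingerprint of the own input, the uniform superposition of the
points `(a, c a)` of the graph of its Reed–Solomon codeword `c` over a field of characteristic two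
with between `2 n` and `O(n)` elements. Adding `w` to the input permutes the basis, by adding the
codeword of `w` to the second coordinate. Hence the answer to a query is yes exactly when exchanging
the inputs `i` and `j`, with `y ⊕ z` added to both, leaves the inputs unchanged, and the referee can
perform the query as a swap test: project every copy onto the vectors that are invariant under the
corresponding involution of the basis. If the answer is yes, the state is invariant; if it is no,
the two states of each copy have inner product at most `1 / 2`, so the projection has norm at most
`(7 / 8) ^ t`. The expected answer thus barely disturbs the state, and the queries can be performed
one after the other on the same copies: after `D` queries the state has moved by at most
`D (7 / 8) ^ t`, whence the error probability is at most `2 D (7 / 8) ^ t`, and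
`t = O(log (D / δ))` copies suffice.

This breaks down when `D / δ` is close to `1`, where the bound requires a protocol of cost `0` for
`D = 1` and `δ` close to `1`. Guessing a leaf at random has error at most `1 - (1 / 2) ^ D`, which
takes care of all cases with `D / δ < 2`.
-/

/-! ### Product states -/

section ProductStates

variable {α : Type*} [Fintype α] {ι : α → Type*}

/-- The product vector `⨂ a, φ a`, written in the product basis. -/
noncomputable def prodState (φ : ∀ a, EuclideanSpace ℂ (ι a)) : EuclideanSpace ℂ (∀ a, ι a) :=
  WithLp.toLp 2 fun b => ∏ a, φ a (b a)

/-- The Kronecker product of a finite family of matrices. -/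
def piKronecker {R : Type*} [CommMonoid R] (M : ∀ a, Matrix (ι a) (ι a) R) :
    Matrix (∀ a, ι a) (∀ a, ι a) R :=
  fun b c => ∏ a, M a (b a) (c a)

theorem star_piKronecker {R : Type*} [CommSemiring R] [StarRing R]
    (M : ∀ a, Matrix (ι a) (ι a) R) : star (piKronecker M) = piKronecker fun a => star (M a) := by
  ext b c
  simp only [Matrix.star_apply, piKronecker, star_prod]

variable [DecidableEq α] [∀ a, Fintype (ι a)]

theorem inner_prodState (φ χ : ∀ a, EuclideanSpace ℂ (ι a)) :
    inner ℂ (prodState φ) (prodState χ) = ∏ a, inner ℂ (φ a) (χ a) := by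
  simp only [PiLp.inner_apply, prodState, RCLike.inner_apply, map_prod, ← Finset.prod_mul_distrib,
    Finset.prod_univ_sum, Fintype.piFinset_univ]

theorem norm_prodState (φ : ∀ a, EuclideanSpace ℂ (ι a)) : ‖prodState φ‖ = ∏ a, ‖φ a‖ := by
  have h := inner_prodState φ φ
  simp only [inner_self_eq_norm_sq_to_K, Finset.prod_pow] at h
  exact (sq_eq_sq₀ (norm_nonneg _) (Finset.prod_nonneg fun a _ => norm_nonneg _)).1
    (by exact_mod_cast h)

theorem norm_prodState_eq_one {φ : ∀ a, EuclideanSpace ℂ (ι a)} (hφ : ∀ a, ‖φ a‖ = 1) :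
    ‖prodState φ‖ = 1 := by
  simp only [norm_prodState, hφ, Finset.prod_const_one]

theorem piKronecker_mul_piKronecker {R : Type*} [CommSemiring R]
    (M N : ∀ a, Matrix (ι a) (ι a) R) :
    piKronecker M * piKronecker N = piKronecker fun a => M a * N a := by
  ext b c
  simp only [Matrix.mul_apply, piKronecker, ← Finset.prod_mul_distrib, Finset.prod_univ_sum,
    Fintype.piFinset_univ]

theorem isStarProjection_piKronecker {R : Type*} [CommSemiring R] [StarRing R]
    {M : ∀ a, Matrix (ι a) (ι a) R} (hM : ∀ a, IsStarProjection (M a)) :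
    IsStarProjection (piKronecker M) where
  isIdempotentElem := by
    rw [IsIdempotentElem, piKronecker_mul_piKronecker]
    exact congrArg piKronecker (funext fun a => (hM a).isIdempotentElem)
  isSelfAdjoint := by
    rw [isSelfAdjoint_iff, star_piKronecker]
    exact congrArg piKronecker (funext fun a => (hM a).isSelfAdjoint)

theorem toEuclideanCLM_piKronecker_prodState [∀ a, DecidableEq (ι a)]
    (M : ∀ a, Matrix (ι a) (ι a) ℂ) (φ : ∀ a, EuclideanSpace ℂ (ι a)) :
    Matrix.toEuclideanCLM (𝕜 := ℂ) (piKronecker M) (prodState φ) =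
      prodState fun a => Matrix.toEuclideanCLM (𝕜 := ℂ) (M a) (φ a) := by
  ext b
  simp only [Matrix.ofLp_toEuclideanCLM, prodState, Matrix.mulVec, dotProduct, piKronecker,
    ← Finset.prod_mul_distrib, Finset.prod_univ_sum, Fintype.piFinset_univ]

end ProductStates

/-! ### The swap test -/

section SwapTest

theorem isStarProjection_half_one_add {A : Type*} [Ring A] [StarRing A] [Algebra ℂ A]
    [StarModule ℂ A] {u : A} (hu : IsSelfAdjoint u) (huu : u * u = 1) :
    IsStarProjection ((2⁻¹ : ℂ) • (1 + u)) where
  isIdempotentElem := by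
    have h : (1 + u) * (1 + u) = (2 : ℂ) • (1 + u) := by
      rw [mul_add, add_mul, add_mul, huu, two_smul]
      simp only [one_mul, mul_one]
      abel
    rw [IsIdempotentElem, smul_mul_smul_comm, h, smul_smul]
    norm_num
  isSelfAdjoint := by
    rw [isSelfAdjoint_iff, star_smul, star_add, star_one, hu.star_eq]
    simp

variable {ι : Type*} [DecidableEq ι]

/-- The accepting projection of the swap test, for the unitary that permutes the basis by `σ`:
the projection onto the `σ`-invariant vectors when `σ` is an involution. -/
noncomputable def swapTest (σ : Equiv.Perm ι) : Matrix ι ι ℂ := (2⁻¹ : ℂ) • (1 + σ.permMatrix ℂ)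

variable [Fintype ι] {σ : Equiv.Perm ι}

theorem isStarProjection_swapTest (hσ : Function.Involutive σ) :
    IsStarProjection (swapTest σ) := by
  have hinv : σ⁻¹ = σ := hσ.symm_eq_self_of_involutive
  refine isStarProjection_half_one_add ?_ ?_
  · rw [isSelfAdjoint_iff, Matrix.star_eq_conjTranspose, Matrix.conjTranspose_permMatrix, hinv]
  · rw [← Matrix.permMatrix_mul, show σ * σ = 1 from Equiv.ext hσ, Matrix.permMatrix_one]

theorem toEuclideanCLM_swapTest (σ : Equiv.Perm ι) (v : EuclideanSpace ℂ ι) :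
    Matrix.toEuclideanCLM (𝕜 := ℂ) (swapTest σ) v =
      (2⁻¹ : ℂ) • (v + WithLp.toLp 2 (v ∘ σ)) := by
  ext a
  simp [swapTest, Matrix.permMatrix_mulVec]

theorem norm_half_smul_add_le {H : Type*} [NormedAddCommGroup H] [InnerProductSpace ℂ H] {u v : H}
    (hu : ‖u‖ = 1) (hv : ‖v‖ = 1) (huv : ‖inner ℂ u v‖ ≤ 1 / 2) :
    ‖(2⁻¹ : ℂ) • (u + v)‖ ≤ 7 / 8 := by
  have hre : RCLike.re (inner ℂ u v) ≤ 1 / 2 := (RCLike.re_le_norm _).trans huv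
  have hsq : ‖u + v‖ ^ 2 ≤ 3 := by
    rw [norm_add_sq (𝕜 := ℂ), hu, hv]
    linarith
  have h : ‖u + v‖ ≤ 7 / 4 := abs_le_of_sq_le_sq' (by linarith) (by norm_num) |>.2
  rw [norm_smul, norm_inv, Complex.norm_ofNat]
  linarith

end SwapTest

/-! ### Measuring along a decision tree -/

theorem norm_sub_mul_apply_le {𝕜 E : Type*} [NontriviallyNormedField 𝕜]
    [SeminormedAddCommGroup E] [NormedSpace 𝕜 E] {A : E →L[𝕜] E} (hA : ‖A‖ ≤ 1) (B : E →L[𝕜] E)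
    (v : E) : ‖v - (A * B) v‖ ≤ ‖v - A v‖ + ‖v - B v‖ :=
  calc ‖v - (A * B) v‖ = ‖(v - A v) + A (v - B v)‖ := by
        rw [map_sub, sub_add_sub_cancel, mul_apply_eq_comp]
    _ ≤ ‖v - A v‖ + ‖A (v - B v)‖ := norm_add_le _ _
    _ ≤ ‖v - A v‖ + ‖v - B v‖ := by
        gcongr
        simpa only [one_mul] using A.le_of_opNorm_le hA (v - B v)

namespace MEQTree

variable {k n : ℕ} {S : Type*}

/-- The leaves of a tree, which serve as the outcomes of the measurement that evaluates it. -/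
def Leaf : MEQTree k n S → Type
  | leaf _ => Unit
  | node _ _ _ _ left right => left.Leaf ⊕ right.Leaf

instance instFintypeLeaf : ∀ T : MEQTree k n S, Fintype T.Leaf
  | leaf _ => inferInstanceAs (Fintype Unit)
  | node _ _ _ _ left right =>
    have := instFintypeLeaf left
    have := instFintypeLeaf right
    inferInstanceAs (Fintype (left.Leaf ⊕ right.Leaf))

/-- The label of a leaf. -/
def label : (T : MEQTree k n S) → T.Leaf → S
  | leaf s, _ => s
  | node _ _ _ _ left _, .inl l => left.label l
  | node _ _ _ _ _ right, .inr l => right.label l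

/-- The leaf that is reached on the inputs `x`. -/
def leafAt (x : Fin k → BitStr n) : (T : MEQTree k n S) → T.Leaf
  | leaf _ => ()
  | node i j y z left right =>
    if meq x i j y z = true then .inr (right.leafAt x) else .inl (left.leafAt x)

theorem leafAt_node_of_meq {x : Fin k → BitStr n} {i j : Fin k} {y z : BitStr n}
    (h : meq x i j y z = true) (left right : MEQTree k n S) :
    (node i j y z left right).leafAt x = .inr (right.leafAt x) :=
  if_pos h

theorem leafAt_node_of_not_meq {x : Fin k → BitStr n} {i j : Fin k} {y z : BitStr n}
    (h : meq x i j y z ≠ true) (left right : MEQTree k n S) :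
    (node i j y z left right).leafAt x = .inl (left.leafAt x) :=
  if_neg h

theorem label_leafAt (x : Fin k → BitStr n) (T : MEQTree k n S) :
    T.label (T.leafAt x) = T.eval x := by
  induction T with
  | leaf s => rfl
  | node i j y z left right ihl ihr =>
    by_cases h : meq x i j y z = true
    · rw [leafAt_node_of_meq h, eval, if_pos h]
      exact ihr
    · rw [leafAt_node_of_not_meq h, eval, if_neg h]
      exact ihl

theorem card_leaf_le (T : MEQTree k n S) : Fintype.card T.Leaf ≤ 2 ^ T.depth := by
  induction T with
  | leaf s => exact le_rfl
  | node _ _ _ _ left right ihl ihr =>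
    calc Fintype.card (left.Leaf ⊕ right.Leaf)
        = Fintype.card left.Leaf + Fintype.card right.Leaf := Fintype.card_sum
      _ ≤ 2 ^ max left.depth right.depth + 2 ^ max left.depth right.depth := by
        gcongr
        · exact ihl.trans (Nat.pow_le_pow_right two_pos (le_max_left _ _))
        · exact ihr.trans (Nat.pow_le_pow_right two_pos (le_max_right _ _))
      _ = 2 ^ (max left.depth right.depth + 1) := by rw [pow_succ, mul_two]

section Kraus

/-- The Kraus operators of the measurement that performs the queries from the root to a leaf one
after the other, the query `(i, j, y, z)` being the projective measurement with operators
`p i j y z` (yes) and `1 - p i j y z` (no). -/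
def kraus {R : Type*} [Ring R] (p : Fin k → Fin k → BitStr n → BitStr n → R) :
    (T : MEQTree k n S) → T.Leaf → R
  | leaf _, _ => 1
  | node i j y z left _, .inl l => left.kraus p l * (1 - p i j y z)
  | node i j y z _ right, .inr l => right.kraus p l * p i j y z

theorem sum_star_kraus_mul_kraus {R : Type*} [Ring R] [StarRing R]
    {p : Fin k → Fin k → BitStr n → BitStr n → R} (hp : ∀ i j y z, IsStarProjection (p i j y z))
    (T : MEQTree k n S) : ∑ l, star (T.kraus p l) * T.kraus p l = 1 := by
  have sandwich : ∀ (T : MEQTree k n S) (e : R), IsStarProjection e →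
      ∑ l, star (T.kraus p l) * T.kraus p l = 1 →
        ∑ l, star (T.kraus p l * e) * (T.kraus p l * e) = e := fun T e he hT => by
    calc ∑ l, star (T.kraus p l * e) * (T.kraus p l * e)
        = star e * (∑ l, star (T.kraus p l) * T.kraus p l) * e := by
          simp only [star_mul, Finset.mul_sum, Finset.sum_mul, mul_assoc]
      _ = e := by rw [hT, mul_one, he.isSelfAdjoint.star_eq, he.isIdempotentElem.eq]
  induction T with
  | leaf s => exact (Fintype.sum_unique (ι := Unit) _).trans (by simp [kraus])
  | node i j y z left right ihl ihr =>
    refine (Fintype.sum_sum_type _).trans ?_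
    simp only [kraus]
    rw [sandwich left _ (hp i j y z).one_sub ihl, sandwich right _ (hp i j y z) ihr,
      sub_add_cancel]

variable {H : Type*} [NormedAddCommGroup H] [InnerProductSpace ℂ H] [CompleteSpace H]
  {p : Fin k → Fin k → BitStr n → BitStr n → H →L[ℂ] H}

theorem norm_kraus_le_one (hp : ∀ i j y z, IsStarProjection (p i j y z)) (T : MEQTree k n S)
    (l : T.Leaf) : ‖T.kraus p l‖ ≤ 1 := by
  induction T with
  | leaf s => exact IsStarProjection.norm_le _ (.one _)
  | node i j y z left right ihl ihr =>
    rcases l with l | l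
    · exact (norm_mul_le _ _).trans (mul_le_one₀ (ihl l) (norm_nonneg _)
        (IsStarProjection.norm_le _ (hp i j y z).one_sub))
    · exact (norm_mul_le _ _).trans (mul_le_one₀ (ihr l) (norm_nonneg _)
        (IsStarProjection.norm_le _ (hp i j y z)))

theorem norm_sub_kraus_leafAt_le (hp : ∀ i j y z, IsStarProjection (p i j y z))
    {x : Fin k → BitStr n} {v : H} {η : ℝ} (hη : 0 ≤ η)
    (hyes : ∀ i j y z, meq x i j y z = true → ‖v - p i j y z v‖ ≤ η)
    (hno : ∀ i j y z, meq x i j y z ≠ true → ‖p i j y z v‖ ≤ η) (T : MEQTree k n S) :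
    ‖v - T.kraus p (T.leafAt x) v‖ ≤ T.depth * η := by
  induction T with
  | leaf s => simp [kraus, depth]
  | node i j y z left right ihl ihr =>
    have step : ∀ d ≤ max left.depth right.depth,
        d * η + η ≤ (max left.depth right.depth + 1 : ℕ) * η := fun d hd => by
      push_cast [-Nat.cast_max]
      rw [add_one_mul]
      gcongr
    by_cases h : meq x i j y z = true
    · rw [leafAt_node_of_meq h]
      exact (norm_sub_mul_apply_le (norm_kraus_le_one hp right _) _ v).trans
        ((add_le_add ihr (hyes i j y z h)).trans (step _ (le_max_right _ _)))
    · have hreject : ‖v - (1 - p i j y z) v‖ ≤ η := by simpa using hno i j y z h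
      rw [leafAt_node_of_not_meq h]
      exact (norm_sub_mul_apply_le (norm_kraus_le_one hp left _) _ v).trans
        ((add_le_add ihl hreject).trans (step _ (le_max_left _ _)))

end Kraus

end MEQTree

/-! ### Protocols from Kraus operators -/

namespace QuantumSMP

variable {k n : ℕ} {S : Type*}

theorem outcomeProb_nonneg (P : QuantumSMP k n S) (x : Fin k → BitStr n) (ω : Fin P.outcomes) :
    0 ≤ P.outcomeProb x ω :=
  (P.effect_posSemidef ω).re_dotProduct_nonneg (P.jointState x)

theorem sum_outcomeProb (P : QuantumSMP k n S) (x : Fin k → BitStr n) :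
    ∑ ω, P.outcomeProb x ω = 1 := by
  have hnorm : ‖prodState fun ℓ => P.message ℓ (x ℓ)‖ = 1 :=
    norm_prodState_eq_one fun ℓ => P.norm_message ℓ (x ℓ)
  have hself : star (P.jointState x) ⬝ᵥ P.jointState x = 1 := by
    rw [dotProduct_comm]
    exact (inner_self_eq_norm_sq_to_K (𝕜 := ℂ) (prodState fun ℓ => P.message ℓ (x ℓ))).trans
      (by simp [hnorm])
  simp only [outcomeProb]
  rw [← Complex.re_sum, ← dotProduct_sum, ← Matrix.sum_mulVec, P.sum_effect, Matrix.one_mulVec,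
    hself, Complex.one_re]

theorem errorProb_le_one_sub_outcomeProb (P : QuantumSMP k n S) (x : Fin k → BitStr n) {s : S}
    {ω : Fin P.outcomes} (hω : P.output ω = s) : P.errorProb x s ≤ 1 - P.outcomeProb x ω := by
  classical
  rw [← P.sum_outcomeProb x, ← Finset.sum_erase_eq_sub (Finset.mem_univ ω), errorProb]
  refine Finset.sum_le_sum_of_subset_of_nonneg (fun ω' hω' => ?_)
    fun ω' _ _ => P.outcomeProb_nonneg x ω'
  refine Finset.mem_erase.2 ⟨?_, Finset.mem_univ _⟩
  rintro rfl
  exact (Finset.mem_filter.1 hω').2 hω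

section OfKraus

variable {H Ω : Type*} [NormedAddCommGroup H] [InnerProductSpace ℂ H] [CompleteSpace H] [Fintype Ω]
  (qubits : Fin k → ℕ) (message : (ℓ : Fin k) → BitStr n → Register (qubits ℓ))
  (norm_message : ∀ ℓ x, ‖message ℓ x‖ = 1)
  (b : OrthonormalBasis ((ℓ : Fin k) → BitStr (qubits ℓ)) ℂ H)
  (K : Ω → H →L[ℂ] H) (hK : ∑ ω, star (K ω) * K ω = 1) (out : Ω → S)

/-- The protocol whose referee measures with Kraus operators `K ω` on a Hilbert space `H` that is
identified with the joint register by the orthonormal basis `b`. The effect `(K ω)† (K ω)`, written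
in the basis `b`, is the Gram matrix of the vectors `K ω (b c)`. -/
noncomputable def ofKraus : QuantumSMP k n S where
  qubits := qubits
  message := message
  norm_message := norm_message
  outcomes := Fintype.card Ω
  effect ω := Matrix.gram ℂ fun c => K ((Fintype.equivFin Ω).symm ω) (b c)
  effect_posSemidef _ := Matrix.posSemidef_gram ℂ _
  sum_effect := by
    ext c d
    calc (∑ ω, Matrix.gram ℂ fun c => K ((Fintype.equivFin Ω).symm ω) (b c)) c d
        = ∑ ω, inner ℂ (K ω (b c)) (K ω (b d)) := by
          rw [Matrix.sum_apply]
          exact (Fintype.equivFin Ω).symm.sum_comp fun ω => inner ℂ (K ω (b c)) (K ω (b d))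
      _ = inner ℂ (b c) ((∑ ω, star (K ω) * K ω) (b d)) := by
          simp [ContinuousLinearMap.star_eq_adjoint, ContinuousLinearMap.adjoint_inner_right,
            sum_apply]
      _ = (1 : Matrix _ _ ℂ) c d := by
          rw [hK, one_apply_eq_self, b.inner_eq_ite, Matrix.one_apply]
  output ω := out ((Fintype.equivFin Ω).symm ω)

theorem errorProb_ofKraus_le (x : Fin k → BitStr n) {Ψ : H}
    (hΨ : ∀ c, b.repr Ψ c = ∏ ℓ, message ℓ (x ℓ) (c ℓ)) {s : S} {ω : Ω} (hω : out ω = s) :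
    (ofKraus qubits message norm_message b K hK out).errorProb x s ≤ 1 - ‖K ω Ψ‖ ^ 2 := by
  set P := ofKraus qubits message norm_message b K hK out
  have hjoint : P.jointState x = b.repr Ψ := funext fun c => (hΨ c).symm
  have himage : ∑ c, b.repr Ψ c • K ω (b c) = K ω Ψ := by
    simp only [← map_smul, ← map_sum, b.sum_repr]
  have heffect : P.effect (Fintype.equivFin Ω ω) = Matrix.gram ℂ fun c => K ω (b c) := by
    simp [P, ofKraus]
  have hprob : P.outcomeProb x (Fintype.equivFin Ω ω) = ‖K ω Ψ‖ ^ 2 :=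
    calc P.outcomeProb x (Fintype.equivFin Ω ω)
        = (star (b.repr Ψ).ofLp ⬝ᵥ (Matrix.gram ℂ fun c => K ω (b c)).mulVec (b.repr Ψ)).re := by
          rw [← hjoint, ← heffect]
          rfl
      _ = (inner ℂ (K ω Ψ) (K ω Ψ)).re := by
          rw [Matrix.star_dotProduct_gram_mulVec, himage]
      _ = ‖K ω Ψ‖ ^ 2 := (norm_sq_eq_re_inner (𝕜 := ℂ) _).symm
  rw [← hprob]
  exact P.errorProb_le_one_sub_outcomeProb x (by simpa [P, ofKraus] using hω)

end OfKraus

end QuantumSMP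

namespace MEQTree

variable {k n : ℕ} {S : Type*}

instance instNonemptyLeaf (T : MEQTree k n S) : Nonempty T.Leaf :=
  ⟨T.leafAt fun _ _ => false⟩

/-- The protocol without communication in which the referee outputs the label of a uniformly random
leaf of the tree. -/
noncomputable def guessProtocol (T : MEQTree k n S) : QuantumSMP k n S :=
  .ofKraus (fun _ => 0) (fun _ _ => EuclideanSpace.single default 1) (by simp)
    (EuclideanSpace.basisFun (Fin k → BitStr 0) ℂ)
    (fun _ : T.Leaf => (√(Fintype.card T.Leaf) : ℂ)⁻¹ • 1)
    (by
      have hcard : (√(Fintype.card T.Leaf) : ℂ) * √(Fintype.card T.Leaf) = Fintype.card T.Leaf := by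
        exact_mod_cast Real.mul_self_sqrt (Nat.cast_nonneg _)
      simp [smul_smul, ← mul_inv, hcard, ← Nat.cast_smul_eq_nsmul ℂ])
    T.label

theorem cost_guessProtocol (T : MEQTree k n S) : T.guessProtocol.cost = 0 :=
  Finset.sum_const_zero

theorem errorProb_guessProtocol_le (T : MEQTree k n S) (x : Fin k → BitStr n) :
    T.guessProtocol.errorProb x (T.eval x) ≤ 1 - (1 / 2) ^ T.depth := by
  set H := EuclideanSpace ℂ (Fin k → BitStr 0)
  have hΨ : ∀ c : Fin k → BitStr 0,
      (EuclideanSpace.basisFun (Fin k → BitStr 0) ℂ).repr (EuclideanSpace.single default 1) c =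
        ∏ ℓ, (EuclideanSpace.single default 1 : Register 0) (c ℓ) := fun c => by
    simp [Subsingleton.elim c default]
  have hnorm : ‖((√(Fintype.card T.Leaf) : ℂ)⁻¹ • 1 : H →L[ℂ] H)
      (EuclideanSpace.single default 1)‖ ^ 2 = (Fintype.card T.Leaf : ℝ)⁻¹ := by
    simp [H, norm_smul]
  refine (QuantumSMP.errorProb_ofKraus_le _ _ _ _ _ _ _ x hΨ (T.label_leafAt x)).trans ?_
  rw [hnorm, one_div_pow, one_div]
  gcongr
  exact_mod_cast T.card_leaf_le

end MEQTree

/-! ### Queries as twisted exchanges -/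

theorem BitStr.involutive_bxor {n : ℕ} (w : BitStr n) :
    Function.Involutive fun x : BitStr n => x.bxor w := fun x => by
  funext t
  simp [BitStr.bxor]

section TwistedSwap

variable {κ α β : Type*} [DecidableEq κ]

/-- The exchange of the entries `i` and `j` of a family, with `τ` applied to both; for `i = j` it
applies `τ` to that entry. -/
def twistedSwap (τ : α → α) (i j : κ) (a : κ → α) : κ → α :=
  fun ℓ => if ℓ = i ∨ ℓ = j then τ (a (Equiv.swap i j ℓ)) else a ℓ

theorem swap_eq_or_eq_iff (i j ℓ : κ) :
    Equiv.swap i j ℓ = i ∨ Equiv.swap i j ℓ = j ↔ ℓ = i ∨ ℓ = j := by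
  rw [Equiv.swap_apply_eq_iff, Equiv.swap_apply_eq_iff, Equiv.swap_apply_left,
    Equiv.swap_apply_right, or_comm]

theorem involutive_twistedSwap {τ : α → α} (hτ : Function.Involutive τ) (i j : κ) :
    Function.Involutive (twistedSwap τ i j) := fun a => by
  funext ℓ
  by_cases h : ℓ = i ∨ ℓ = j
  · simp only [twistedSwap, swap_eq_or_eq_iff, if_pos h, Equiv.swap_apply_self, hτ (a ℓ)]
  · simp only [twistedSwap, if_neg h]

theorem twistedSwap_eq_self_iff {τ : α → α} (hτ : Function.Involutive τ) {i j : κ} {a : κ → α} :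
    twistedSwap τ i j a = a ↔ τ (a j) = a i := by
  refine ⟨fun h => ?_, fun h => funext fun ℓ => ?_⟩
  · simpa [twistedSwap] using congrFun h i
  · by_cases hi : ℓ = i
    · simp [twistedSwap, hi, h]
    · by_cases hj : ℓ = j
      · simp [twistedSwap, hj, ← h, hτ (a j)]
      · simp [twistedSwap, hi, hj]

theorem prod_twistedSwap [Fintype κ] {M : Type*} [CommMonoid M] {τ : α → α} {σ : β → β}
    {F : α → β → M} (hF : ∀ a b, F a (σ b) = F (τ a) b) (i j : κ) (a : κ → α) (b : κ → β) :
    ∏ ℓ, F (a ℓ) (twistedSwap σ i j b ℓ) = ∏ ℓ, F (twistedSwap τ i j a ℓ) (b ℓ) := by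
  rw [← Equiv.prod_comp (Equiv.swap i j)]
  refine Finset.prod_congr rfl fun ℓ _ => ?_
  by_cases h : ℓ = i ∨ ℓ = j
  · simp only [twistedSwap, swap_eq_or_eq_iff, if_pos h, Equiv.swap_apply_self, hF]
  · rw [not_or] at h
    simp [twistedSwap, h.1, h.2, Equiv.swap_apply_of_ne_of_ne h.1 h.2]

theorem meq_iff_twistedSwap_eq_self {k n : ℕ} {x : Fin k → BitStr n} {i j : Fin k}
    {y z : BitStr n} :
    meq x i j y z = true ↔ twistedSwap (fun u => u.bxor (z.bxor y)) i j x = x := by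
  rw [twistedSwap_eq_self_iff (BitStr.involutive_bxor _), meq, decide_eq_true_iff]
  have hassoc : (x j).bxor (z.bxor y) = ((x j).bxor z).bxor y := by
    funext t
    simp [BitStr.bxor]
  rw [hassoc, (BitStr.involutive_bxor y).eq_iff, eq_comm]

end TwistedSwap

/-! ### Fingerprints -/

/-- Quantum fingerprints of the bit strings of length `n`: unit vectors that are far from parallel
for different strings, such that replacing `x` by `x ⊕ w` permutes the amplitudes by the involution
`shift w`. -/
structure Fingerprint (n : ℕ) (G : Type*) [Fintype G] where
  state : BitStr n → EuclideanSpace ℂ G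
  norm_state : ∀ x, ‖state x‖ = 1
  norm_inner_le : ∀ x y, x ≠ y → ‖inner ℂ (state x) (state y)‖ ≤ 1 / 2
  shift : BitStr n → G → G
  involutive_shift : ∀ w, Function.Involutive (shift w)
  state_shift : ∀ x w g, state x (shift w g) = state (x.bxor w) g

namespace Fingerprint

variable {k n : ℕ} {G : Type*} [Fintype G] (Φ : Fingerprint n G)

/-- The product of the fingerprints of all inputs. -/
noncomputable def joint (x : Fin k → BitStr n) : EuclideanSpace ℂ (Fin k → G) :=
  prodState fun ℓ => Φ.state (x ℓ)

theorem norm_joint (x : Fin k → BitStr n) : ‖Φ.joint x‖ = 1 :=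
  norm_prodState_eq_one fun ℓ => Φ.norm_state (x ℓ)

theorem norm_inner_joint_le {x x' : Fin k → BitStr n} (hx : x ≠ x') :
    ‖inner ℂ (Φ.joint x) (Φ.joint x')‖ ≤ 1 / 2 := by
  obtain ⟨m, hm⟩ := Function.ne_iff.1 hx
  have hle : ∀ ℓ, ‖inner ℂ (Φ.state (x ℓ)) (Φ.state (x' ℓ))‖ ≤ 1 := fun ℓ => by
    simpa only [Φ.norm_state, mul_one] using 
      norm_inner_le_norm (𝕜 := ℂ) (Φ.state (x ℓ)) (Φ.state (x' ℓ))
  rw [joint, joint, inner_prodState, norm_prod, Fintype.prod_eq_mul_prod_compl m, ← mul_one (1 / 2)]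
  gcongr
  · exact Φ.norm_inner_le _ _ hm
  · exact Finset.prod_le_one (fun _ _ => norm_nonneg _) fun ℓ _ => hle ℓ

/-- The permutation of the basis that maps the joint fingerprint of the inputs `x` to that of the
inputs obtained from `x` by exchanging `x i` and `x j` and adding `y ⊕ z` to both. -/
def exchange (i j : Fin k) (y z : BitStr n) : Equiv.Perm (Fin k → G) :=
  (involutive_twistedSwap (Φ.involutive_shift (z.bxor y)) i j).toPerm

theorem joint_comp_exchange (i j : Fin k) (y z : BitStr n) (x : Fin k → BitStr n) :
    WithLp.toLp 2 (Φ.joint x ∘ Φ.exchange i j y z) =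
      Φ.joint (twistedSwap (fun u => u.bxor (z.bxor y)) i j x) := by
  ext g
  exact prod_twistedSwap (F := fun x g => Φ.state x g) (fun x g => Φ.state_shift x _ g) i j x g

/-- `t` copies of the joint fingerprint. -/
noncomputable def copies (t : ℕ) (x : Fin k → BitStr n) : EuclideanSpace ℂ (Fin t → Fin k → G) :=
  prodState fun _ => Φ.joint x

theorem norm_copies (t : ℕ) (x : Fin k → BitStr n) : ‖Φ.copies t x‖ = 1 :=
  norm_prodState_eq_one fun _ => Φ.norm_joint x

variable [DecidableEq G]

/-- The projection that answers the query `(i, j, y, z)` with yes: all `t` copies pass the swap test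
for `exchange i j y z`. -/
noncomputable def queryProj (t : ℕ) (i j : Fin k) (y z : BitStr n) :
    EuclideanSpace ℂ (Fin t → Fin k → G) →L[ℂ] EuclideanSpace ℂ (Fin t → Fin k → G) :=
  Matrix.toEuclideanCLM (𝕜 := ℂ) (piKronecker fun _ => swapTest (Φ.exchange i j y z))

theorem isStarProjection_queryProj (t : ℕ) (i j : Fin k) (y z : BitStr n) :
    IsStarProjection (Φ.queryProj t i j y z) :=
  (isStarProjection_piKronecker fun _ =>
    isStarProjection_swapTest (involutive_twistedSwap (Φ.involutive_shift _) i j)).map _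

theorem queryProj_copies (t : ℕ) (i j : Fin k) (y z : BitStr n) (x : Fin k → BitStr n) :
    Φ.queryProj t i j y z (Φ.copies t x) =
      prodState fun _ => (2⁻¹ : ℂ) •
        (Φ.joint x + Φ.joint (twistedSwap (fun u => u.bxor (z.bxor y)) i j x)) := by
  rw [queryProj, copies, toEuclideanCLM_piKronecker_prodState]
  simp only [toEuclideanCLM_swapTest, joint_comp_exchange]

theorem queryProj_copies_of_meq (t : ℕ) {x : Fin k → BitStr n} {i j : Fin k} {y z : BitStr n}
    (h : meq x i j y z = true) : Φ.queryProj t i j y z (Φ.copies t x) = Φ.copies t x := by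
  rw [queryProj_copies, meq_iff_twistedSwap_eq_self.1 h, ← two_smul ℂ, smul_smul,
    inv_mul_cancel₀ two_ne_zero, one_smul, copies]

theorem norm_queryProj_copies_le (t : ℕ) {x : Fin k → BitStr n} {i j : Fin k} {y z : BitStr n}
    (h : meq x i j y z ≠ true) : ‖Φ.queryProj t i j y z (Φ.copies t x)‖ ≤ (7 / 8) ^ t := by
  rw [queryProj_copies, norm_prodState, Finset.prod_const, Finset.card_univ, Fintype.card_fin]
  gcongr
  exact norm_half_smul_add_le (Φ.norm_joint _) (Φ.norm_joint _)
    (Φ.norm_inner_joint_le fun hx => h (meq_iff_twistedSwap_eq_self.2 hx.symm))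

theorem norm_copies_sub_kraus_leafAt_le {S : Type*} (t : ℕ) (T : MEQTree k n S)
    (x : Fin k → BitStr n) :
    ‖Φ.copies t x - T.kraus (Φ.queryProj t) (T.leafAt x) (Φ.copies t x)‖ ≤
      T.depth * (7 / 8) ^ t := by
  refine T.norm_sub_kraus_leafAt_le (Φ.isStarProjection_queryProj t) (by positivity)
    (fun i j y z h => ?_) fun i j y z h => Φ.norm_queryProj_copies_le t h
  rw [Φ.queryProj_copies_of_meq t h, sub_self, norm_zero]
  positivity

end Fingerprint

/-! ### The fingerprint protocol -/

theorem one_sub_norm_sq_le_two_mul_norm_sub {E : Type*} [SeminormedAddCommGroup E] {u v : E}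
    (hu : ‖u‖ = 1) : 1 - ‖v‖ ^ 2 ≤ 2 * ‖u - v‖ := by
  have h := norm_sub_norm_le u v
  nlinarith [norm_nonneg v, sq_nonneg (1 - ‖v‖)]

namespace Fingerprint

variable {k n r : ℕ} {G S : Type*} [Fintype G]

/-- The encoding of a string of `t` symbols by `t * r` bits, for an alphabet of size `2 ^ r`. -/
noncomputable def encode (hG : Fintype.card G = 2 ^ r) (t : ℕ) : BitStr (t * r) ≃ (Fin t → G) :=
  Fintype.equivOfCardEq (by simp [hG, pow_mul'])

variable [DecidableEq G] (Φ : Fingerprint n G)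

/-- The protocol in which every player sends `t` copies of the fingerprint of the own input and the
referee evaluates the tree by measuring `queryProj`. -/
noncomputable def protocol (hG : Fintype.card G = 2 ^ r) (t : ℕ) (T : MEQTree k n S) :
    QuantumSMP k n S :=
  .ofKraus (fun _ => t * r)
    (fun _ x => LinearIsometryEquiv.piLpCongrLeft 2 ℂ ℂ (encode hG t).symm
      (prodState fun _ => Φ.state x))
    (fun _ x => by simp only [LinearIsometryEquiv.norm_map, norm_prodState, Φ.norm_state,
      Finset.prod_const_one])
    ((EuclideanSpace.basisFun _ ℂ).reindex
      ((Equiv.piCongrRight fun _ => encode hG t).trans (Equiv.piComm _)).symm)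
    (T.kraus (Φ.queryProj t)) (T.sum_star_kraus_mul_kraus (Φ.isStarProjection_queryProj t)) T.label

theorem cost_protocol (hG : Fintype.card G = 2 ^ r) (t : ℕ) (T : MEQTree k n S) :
    (Φ.protocol hG t T).cost = k * (t * r) :=
  Fin.sum_const k (t * r)

theorem errorProb_protocol_le (hG : Fintype.card G = 2 ^ r) (t : ℕ) (T : MEQTree k n S)
    (x : Fin k → BitStr n) :
    (Φ.protocol hG t T).errorProb x (T.eval x) ≤ 2 * T.depth * (7 / 8) ^ t := by
  refine (QuantumSMP.errorProb_ofKraus_le _ _ _ _ _ _ _ x (Ψ := Φ.copies t x) (fun c => ?_)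
    (T.label_leafAt x)).trans ?_
  · simp only [OrthonormalBasis.repr_reindex, EuclideanSpace.basisFun_repr,
      LinearIsometryEquiv.piLpCongrLeft_apply, Equiv.piCongrLeft'_apply, Equiv.symm_symm,
      copies, joint, prodState]
    exact Finset.prod_comm
  · rw [mul_assoc]
    exact (one_sub_norm_sq_le_two_mul_norm_sub (Φ.norm_copies t x)).trans
      (mul_le_mul_of_nonneg_left (Φ.norm_copies_sub_kraus_leafAt_le t T x) zero_le_two)

end Fingerprint

/-! ### Fingerprints from codes -/

section GraphState

variable {α β : Type*} [Fintype α] [DecidableEq β]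

/-- The uniform superposition of the points `(a, h a)` of the graph of `h`. -/
noncomputable def graphState (h : α → β) : EuclideanSpace ℂ (α × β) :=
  WithLp.toLp 2 fun p => if h p.1 = p.2 then (√(Fintype.card α) : ℂ)⁻¹ else 0

variable [Fintype β]

theorem inner_graphState (h h' : α → β) :
    inner ℂ (graphState h) (graphState h') =
      (Fintype.card {a // h a = h' a} : ℂ) / Fintype.card α := by
  have hcard : (√(Fintype.card α) : ℂ) * √(Fintype.card α) = Fintype.card α := by
    exact_mod_cast Real.mul_self_sqrt (Nat.cast_nonneg _)
  have hsum : ∀ a, ∑ b, inner ℂ (graphState h (a, b)) (graphState h' (a, b)) =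
      if h a = h' a then (Fintype.card α : ℂ)⁻¹ else 0 := fun a => by
    simp only [graphState, RCLike.inner_apply]
    by_cases ha : h a = h' a <;> simp [ha, ← hcard]
  rw [PiLp.inner_apply, Fintype.sum_prod_type, Finset.sum_congr rfl fun a _ => hsum a]
  simp [Finset.sum_ite, Fintype.card_subtype, div_eq_mul_inv]

theorem norm_graphState [Nonempty α] (h : α → β) : ‖graphState h‖ = 1 := by
  have hsq : ‖graphState h‖ ^ 2 = 1 := by
    rw [norm_sq_eq_re_inner (𝕜 := ℂ), inner_graphState,
      Fintype.card_congr (Equiv.subtypeUnivEquiv fun _ => rfl), div_self (by simp), RCLike.one_re]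
  exact (pow_eq_one_iff_of_nonneg (norm_nonneg _) two_ne_zero).1 hsq

end GraphState

/-- The fingerprints `∑ a, |a⟩|c x a⟩` of a code `c`, over a ring of characteristic two, in
which different codewords agree on at most half of the positions. -/
noncomputable def Fingerprint.ofCode {n : ℕ} {α A : Type*} [Fintype α] [Nonempty α] [Fintype A]
    [DecidableEq A] [Ring A] [CharP A 2] (c : BitStr n → α → A)
    (c_bxor : ∀ x w a, c (x.bxor w) a = c x a + c w a)
    (two_mul_agree_le : ∀ x y, x ≠ y → 2 * Fintype.card {a // c x a = c y a} ≤ Fintype.card α) :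
    Fingerprint n (α × A) where
  state x := graphState (c x)
  norm_state x := norm_graphState (c x)
  norm_inner_le x y hxy := by
    have h : 2 * (Fintype.card {a // c x a = c y a} : ℝ) ≤ Fintype.card α := by
      exact_mod_cast two_mul_agree_le x y hxy
    rw [inner_graphState, norm_div, Complex.norm_natCast, Complex.norm_natCast,
      div_le_div_iff₀ (by positivity) two_pos]
    linarith
  shift w p := (p.1, p.2 + c w p.1)
  involutive_shift w p := by
    simp only [add_assoc, CharTwo.add_self_eq_zero, add_zero]
  state_shift x w p := by
    simp only [graphState, c_bxor, ← CharTwo.sub_eq_add, sub_eq_iff_eq_add]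

section ReedSolomon

variable {n : ℕ} (F : Type*) [Field F] [DecidableEq F]

/-- The message polynomial of the Reed–Solomon code for a bit string. -/
noncomputable def bitPoly (x : BitStr n) : Polynomial F :=
  Polynomial.ofFn n fun t => if x t then 1 else 0

variable {F}

theorem bitPoly_injective : Function.Injective (bitPoly F : BitStr n → Polynomial F) := by
  intro x y h
  funext t
  have ht := congrFun (Polynomial.injective_ofFn n h) t
  cases hx : x t <;> cases hy : y t <;> simp_all

theorem bitPoly_bxor [CharP F 2] (x y : BitStr n) :
    bitPoly F (x.bxor y) = bitPoly F x + bitPoly F y := by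
  rw [bitPoly, bitPoly, bitPoly, ← map_add]
  congr 1
  funext t
  cases hx : x t <;> cases hy : y t <;> simp [BitStr.bxor, hx, hy, CharTwo.add_self_eq_zero]

theorem card_eval_bitPoly_eq_lt [Fintype F] {x y : BitStr n} (hxy : x ≠ y) :
    Fintype.card {a // (bitPoly F x).eval a = (bitPoly F y).eval a} < n := by
  by_contra! h
  rw [Fintype.card_subtype] at h
  refine hxy (bitPoly_injective (Polynomial.eq_of_degrees_lt_of_eval_finset_eq _
    ((Polynomial.ofFn_degree_lt _).trans_le (by exact_mod_cast h))
    ((Polynomial.ofFn_degree_lt _).trans_le (by exact_mod_cast h)) fun a ha => ?_))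
  exact (Finset.mem_filter.1 ha).2

/-- The fingerprints of the Reed–Solomon code over a field of characteristic two. -/
noncomputable def Fingerprint.reedSolomon [Fintype F] [CharP F 2] (hF : 2 * n ≤ Fintype.card F) :
    Fingerprint n (F × F) :=
  .ofCode (fun x a => (bitPoly F x).eval a)
    (fun x w a => by rw [bitPoly_bxor, Polynomial.eval_add]) fun x y hxy =>
      (Nat.mul_le_mul_left 2 (card_eval_bitPoly_eq_lt hxy).le).trans hF

end ReedSolomon

open Classical in
theorem exists_fingerprint (n : ℕ) : ∃ (G : Type) (_ : Fintype G) (_ : Fingerprint n G) (r : ℕ),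
    Fintype.card G = 2 ^ r ∧ r ≤ 12 * Real.log (max n 2 : ℕ) := by
  set m := max n 2
  set r := Nat.log 2 m + 2
  let F := GaloisField 2 r
  let _ : Fintype F := .ofFinite F
  have hcard : Fintype.card F = 2 ^ r := by
    rw [Fintype.card_eq_nat_card, GaloisField.card 2 r (by omega)]
  have hnF : 2 * n ≤ Fintype.card F := by
    have h : m < 2 ^ (Nat.log 2 m + 1) := Nat.lt_pow_succ_log_self one_lt_two m
    rw [hcard, pow_succ]
    omega
  refine ⟨F × F, inferInstance, .reedSolomon hnF, 2 * r, ?_, ?_⟩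
  · rw [Fintype.card_prod, hcard, ← pow_add, two_mul]
  · have hlog : (Nat.log 2 m : ℝ) ≤ Real.log m / Real.log 2 := Real.natLog_le_logb m 2
    have hlog2 : 1 / 2 < Real.log 2 := Real.log_two_gt_d9.trans' (by norm_num)
    have hm : Real.log 2 ≤ Real.log m :=
      Real.log_le_log two_pos (by exact_mod_cast le_max_right _ _)
    have hlog' : (Nat.log 2 m : ℝ) ≤ 2 * Real.log m :=
      hlog.trans ((div_le_iff₀ (by linarith)).2 (by nlinarith))
    push_cast [r]
    linarith

/-! ### Parameters -/

theorem exists_two_mul_mul_pow_le_one {X : ℝ} (hX : 2 ≤ X) :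
    ∃ t : ℕ, 2 * X * (7 / 8) ^ t ≤ 1 ∧ t ≤ 18 * Real.log X := by
  have hlog2 : 1 / 2 < Real.log 2 := Real.log_two_gt_d9.trans' (by norm_num)
  have hlogX : Real.log 2 ≤ Real.log X := Real.log_le_log two_pos hX
  have hlog : Real.log (2 * X) = Real.log 2 + Real.log X :=
    Real.log_mul two_ne_zero (by linarith)
  refine ⟨⌈8 * Real.log (2 * X)⌉₊, ?_, ?_⟩
  · calc 2 * X * (7 / 8 : ℝ) ^ ⌈8 * Real.log (2 * X)⌉₊
        ≤ 2 * X * Real.exp (-(1 / 8)) ^ ⌈8 * Real.log (2 * X)⌉₊ := by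
          gcongr
          linarith [Real.one_sub_le_exp_neg (1 / 8)]
      _ ≤ 2 * X * Real.exp (-Real.log (2 * X)) := by
          rw [← Real.exp_nat_mul]
          gcongr
          linarith [Nat.le_ceil (8 * Real.log (2 * X))]
      _ = 1 := by
          rw [Real.exp_neg, Real.exp_log (by linarith), mul_inv_cancel₀ (by linarith)]
  · linarith [Nat.ceil_lt_add_one (show 0 ≤ 8 * Real.log (2 * X) by linarith)]

theorem two_le_div_of_lt_one_sub_half_pow {d : ℕ} {δ : ℝ} (hδ : 0 < δ)
    (h : δ < 1 - (1 / 2) ^ d) : 2 ≤ d / δ := by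
  have hbernoulli : 1 + d * (-(1 / 2) : ℝ) ≤ (1 + -(1 / 2)) ^ d :=
    one_add_mul_le_pow (by norm_num) d
  norm_num at hbernoulli h
  rw [le_div_iff₀ hδ]
  linarith

theorem exists_two_mul_mul_pow_le {d : ℕ} {δ : ℝ} (hδ : 0 < δ) (h : δ < 1 - (1 / 2) ^ d) :
    ∃ t : ℕ, 2 * d * (7 / 8) ^ t ≤ δ ∧
      t ≤ 18 * (Real.log (max d 1 : ℕ) + Real.log (1 / δ)) := by
  have hX : 2 ≤ d / δ := two_le_div_of_lt_one_sub_half_pow hδ h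
  obtain ⟨t, herr, ht⟩ := exists_two_mul_mul_pow_le_one hX
  refine ⟨t, ?_, ht.trans ?_⟩
  · calc 2 * d * (7 / 8 : ℝ) ^ t = 2 * (d / δ) * (7 / 8) ^ t * δ := by field_simp
      _ ≤ δ := mul_le_of_le_one_left hδ.le herr
  · rw [← Real.log_mul (by positivity) (by positivity), mul_one_div]
    gcongr
    exact le_max_left d 1

theorem theorem1 :
    ∃ C : ℝ, 0 < C ∧
      ∀ (n k D : ℕ) (δ : ℝ), 0 < δ → δ < 1 →
        ∀ (S : Type*) (T : MEQTree k n S), T.depth = D →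
          ∃ P : QuantumSMP k n S,
            (P.cost : ℝ) ≤
              C * (k * (Real.log (max D 1 : ℕ) + Real.log (1 / δ)) * Real.log (max n 2 : ℕ)) ∧
            ∀ x : Fin k → BitStr n, P.errorProb x (T.eval x) ≤ δ := by
  classical
  refine ⟨216, by norm_num, fun n k D δ hδ hδ1 S T hD => ?_⟩
  subst hD
  set L := Real.log (max T.depth 1 : ℕ) + Real.log (1 / δ)
  have hL : 0 ≤ L :=
    add_nonneg (Real.log_natCast_nonneg _) (Real.log_nonneg ((one_le_div hδ).2 hδ1.le))
  rcases le_or_gt (1 - (1 / 2) ^ T.depth : ℝ) δ with hguess | hδT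
  · refine ⟨T.guessProtocol, ?_, fun x => (T.errorProb_guessProtocol_le x).trans hguess⟩
    rw [T.cost_guessProtocol, Nat.cast_zero]
    positivity
  · obtain ⟨G, _, Φ, r, hG, hr⟩ := exists_fingerprint n
    obtain ⟨t, herr, ht⟩ := exists_two_mul_mul_pow_le hδ hδT
    refine ⟨Φ.protocol hG t T, ?_, fun x => (Φ.errorProb_protocol_le hG t T x).trans herr⟩
    calc ((Φ.protocol hG t T).cost : ℝ) = k * (t * r) := by exact_mod_cast Φ.cost_protocol hG t T
      _ ≤ k * (18 * L * (12 * Real.log (max n 2 : ℕ))) := by gcongr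
      _ = 216 * (k * L * Real.log (max n 2 : ℕ)) := by ring
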